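/- For real $\epsilon,\epsilon'$, $\zeta\in\mathbb{C}$ and $\tau\in\mathbb{C}$ with $\operatorname{Im}\tau>0$, let $$\theta\begin{bmatrix}\epsilon\\ \epsilon'\end{bmatrix}(\zeta,\tau)=\sum_{n\in\mathbb{Z}}\exp\left(2\pi i\left[\tfrac12\left(n+\tfrac{\epsilon}{2}\right)^2\tau+\left(n+\tfrac{\epsilon}{2}\right)\left(\zeta+\tfrac{\epsilon'}{2}\right)\right]\right),$$ and for $|x|<1$ let $(x;x)_\infty=\prod_{n=1}^\infty(1-x^n)$. For $\operatorname{Im}\tau>0$ set $q=\exp(2\pi i\tau)$ and $$W=\frac{\theta^5\begin{bmatrix}1\\ 1/5\end{bmatrix}(0,\tau)}{\theta^5\begin{bmatrix}1\\ 3/5\end{bmatrix}(0,\tau)}.$$ Then the denominator has no zero in the upper half plane, $W$ is a complex differentiable function of $q$ on the punctured unit disc $0<|q|<1$, and there it satisfies the Riccati equation $$q\frac{dW}{dq}=\frac{1}{(\sqrt5)^3}\,\frac{(q;q)_\infty^5}{(q^5;q^5)_\infty}\left(W^2-11W-1\right).$$ -/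

import Mathlib

noncomputable section

namespace LevelFive

/-- The theta function with real characteristics `ε`, `ε'`:
`θ[ε; ε'](ζ, τ) = ∑_{n ∈ ℤ} exp (2πi (½ (n + ε/2)² τ + (n + ε/2) (ζ + ε'/2)))`,
an absolutely convergent series when `0 < Im τ`. -/
def theta (ε ε' : ℝ) (ζ τ : ℂ) : ℂ :=
  ∑' n : ℤ, Complex.exp (2 * Real.pi * Complex.I *
    (1 / 2 * ((n : ℂ) + (ε : ℂ) / 2) ^ 2 * τ +
      ((n : ℂ) + (ε : ℂ) / 2) * (ζ + (ε' : ℂ) / 2)))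

/-- The nome `q = exp (2πiτ)`. -/
def nome (τ : ℂ) : ℂ := Complex.exp (2 * Real.pi * Complex.I * τ)

/-- The Euler product `(x; x)_∞ = ∏_{n ≥ 1} (1 - x ^ n)`, convergent for `‖x‖ < 1`;
the index `n : ℕ` starts at `0`, whence the exponent `n + 1`. -/
def eulerProduct (x : ℂ) : ℂ := ∏' n : ℕ, (1 - x ^ (n + 1))

/-- `W(τ) = θ⁵[1; 1/5](0, τ) / θ⁵[1; 3/5](0, τ)`. -/
def W (τ : ℂ) : ℂ := theta 1 (1 / 5) 0 τ ^ 5 / theta 1 (3 / 5) 0 τ ^ 5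

end LevelFive

end

/-!
Write `θ(ζ)` for the odd theta function `θ[1; 1](ζ, τ)`, `Z = θ'/θ` for its logarithmic derivative
in `ζ`, and `T₁ = θ(1/5)`, `T₂ = θ(2/5)`. A characteristic is a translation of the argument, so
`W = (T₂ / T₁) ^ 5`, and the Riccati equation is a statement about an elliptic curve at its points
of order five.

The product `θ(x + y) θ(x - y)` is a `2 × 2` determinant of even theta functions
(`theta_add_mul_theta_sub`), whence Weierstrass's three-term identity is a Plücker relation
(`theta_three_term`). Differentiating it once gives
`3 Z(w) - Z(3 w) = θ'(0) θ(2 w) ^ 3 / (θ(w) ^ 3 θ(3 w))` (`theta_triplication`), and once more it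
gives `Z'(y) - Z'(x)` as a product of thetas (`theta_logDeriv_deriv_sub`). At the five-division
points, where `θ(3/5) = T₂` and `θ(6/5) = -T₁`, the combinations
`u = 3 Z(1/5) + Z(2/5)` and `v = Z(1/5) - 3 Z(2/5)` therefore satisfy
`u = θ'(0) T₂ ^ 2 / T₁ ^ 3`, `v = θ'(0) T₁ ^ 2 / T₂ ^ 3` and `Z'(2/5) - Z'(1/5) = u v`; in
particular `u = W v`.

By the heat equation (`hasDerivAt_thetaDeriv_right`), `4πi d(log W)/dτ` is
`5 (θ''/θ(2/5) - θ''/θ(1/5))`, and `θ''/θ = Z' + Z ^ 2`. This is the quadratic form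
`2/5 (v ^ 2 + 11 u v - u ^ 2) = -2/5 u v (W - 11 - 1/W)` (`riccati_algebra`). Finally
`u v = θ'(0) ^ 2 / (T₁ T₂)` is `4π² / √5` times `(q; q)_∞ ^ 5 / (q ^ 5; q ^ 5)_∞` by the Jacobi
triple product (`tsum_eq_tripleProduct`), which is proved from its finite form; it also shows that
`T₁` and `T₂` do not vanish. Since `W` has period one in `τ`, it is a function of `q`.
-/

open Filter Topology

/-! ### The Jacobi triple product -/

namespace LevelFive

/-- The finite product `(q; q)_n = ∏_{k=1}^n (1 - q ^ k)`. -/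
noncomputable def qFactorial (q : ℂ) (n : ℕ) : ℂ := ∏ k ∈ Finset.range n, (1 - q ^ (k + 1))

/-- The reciprocal `1 / (q; q)_j`, extended by zero to negative `j`, so that
`1 / (q; q)_{j-1} = (1 - q ^ j) / (q; q)_j` holds for every integer `j`. -/
noncomputable def qFactorialInv (q : ℂ) (j : ℤ) : ℂ :=
  if 0 ≤ j then (qFactorial q j.toNat)⁻¹ else 0

lemma one_sub_pow_succ_ne_zero {q : ℂ} (hq : ‖q‖ < 1) (k : ℕ) : 1 - q ^ (k + 1) ≠ 0 := by
  intro h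
  have h1 : ‖q ^ (k + 1)‖ = 1 := by rw [← sub_eq_zero.mp h, norm_one]
  rw [norm_pow] at h1
  exact (pow_lt_one₀ (norm_nonneg _) hq (Nat.succ_ne_zero k)).ne h1

lemma qFactorial_ne_zero {q : ℂ} (hq : ‖q‖ < 1) (n : ℕ) : qFactorial q n ≠ 0 :=
  Finset.prod_ne_zero_iff.mpr fun k _ ↦ one_sub_pow_succ_ne_zero hq k

lemma qFactorialInv_sub_one {q : ℂ} (hq : ‖q‖ < 1) (j : ℤ) :
    qFactorialInv q (j - 1) = (1 - q ^ j) * qFactorialInv q j := by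
  rcases lt_trichotomy j 0 with h | rfl | h
  · rw [qFactorialInv, qFactorialInv, if_neg (by omega), if_neg (by omega), mul_zero]
  · simp [qFactorialInv]
  · obtain ⟨n, rfl⟩ : ∃ n : ℕ, j = n + 1 := ⟨(j - 1).toNat, by omega⟩
    have h1 := one_sub_pow_succ_ne_zero hq n
    have h2 := qFactorial_ne_zero hq n
    have h3 : ((n : ℤ) + 1).toNat = n + 1 := by omega
    rw [qFactorialInv, qFactorialInv, if_pos (by omega), if_pos (by omega), h3, add_sub_cancel_right,
      Int.toNat_natCast, show qFactorial q (n + 1) = qFactorial q n * (1 - q ^ (n + 1)) from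
      Finset.prod_range_succ _ _]
    have : q ^ ((n : ℤ) + 1) = q ^ (n + 1) := by exact_mod_cast zpow_natCast q (n + 1)
    rw [this]
    field_simp

lemma eulerProduct_ne_zero {q : ℂ} (hq : ‖q‖ < 1) : eulerProduct q ≠ 0 := by
  have h := tprod_one_add_ne_zero_of_summable (f := fun n : ℕ ↦ -q ^ (n + 1))
    (fun i ↦ by simpa [← sub_eq_add_neg] using one_sub_pow_succ_ne_zero hq i)
    (by simpa using (summable_nat_add_iff 1).mpr
          (summable_geometric_of_lt_one (norm_nonneg _) hq))
  simpa [eulerProduct, sub_eq_add_neg] using h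

lemma tendsto_qFactorial {q : ℂ} (hq : ‖q‖ < 1) :
    Tendsto (qFactorial q) atTop (𝓝 (eulerProduct q)) :=
  (ModularForm.multipliable_one_sub_pow hq).tendsto_prod_tprod_nat

lemma tendsto_qFactorialInv {q : ℂ} (hq : ‖q‖ < 1) {a : ℕ → ℤ} (ha : Tendsto a atTop atTop) :
    Tendsto (fun N ↦ qFactorialInv q (a N)) atTop (𝓝 (eulerProduct q)⁻¹) := by
  have h1 : Tendsto (fun N ↦ (a N).toNat) atTop atTop := by
    refine tendsto_atTop.mpr fun b ↦ ?_
    filter_upwards [ha.eventually_ge_atTop (b : ℤ)] with N hN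
    omega
  refine (((tendsto_qFactorial hq).comp h1).inv₀ (eulerProduct_ne_zero hq)).congr' ?_
  filter_upwards [ha.eventually_ge_atTop 0] with N hN
  simp [qFactorialInv, hN]

lemma exists_norm_qFactorial_le {q : ℂ} (hq : ‖q‖ < 1) : ∃ C, ∀ n, ‖qFactorial q n‖ ≤ C := by
  obtain ⟨C, hC⟩ := (tendsto_qFactorial hq).norm.bddAbove_range
  exact ⟨C, fun n ↦ hC ⟨n, rfl⟩⟩

lemma exists_norm_qFactorialInv_le {q : ℂ} (hq : ‖q‖ < 1) :
    ∃ C, 0 ≤ C ∧ ∀ j, ‖qFactorialInv q j‖ ≤ C := by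
  obtain ⟨C, hC⟩ :=
    ((tendsto_qFactorial hq).inv₀ (eulerProduct_ne_zero hq)).norm.bddAbove_range
  have hC' (n : ℕ) : ‖(qFactorial q n)⁻¹‖ ≤ C := hC ⟨n, rfl⟩
  have h0 : 0 ≤ C := (norm_nonneg _).trans (hC' 0)
  refine ⟨C, h0, fun j ↦ ?_⟩
  rw [qFactorialInv]
  split_ifs
  · exact hC' _
  · simpa using h0

/-- The finite form of the triple product: a Laurent polynomial identity, whose coefficients are
Gaussian binomial coefficients with top entry `2 * N`. -/
lemma hasSum_finite_tripleProduct {q x : ℂ} (hq : ‖q‖ < 1) (hq0 : q ≠ 0) (hx : x ≠ 0)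
    {f : ℤ → ℂ} (hf0 : f 0 = 1) (hf : ∀ n, f (n + 1) = -(x * q ^ (n + 1)) * f n) (N : ℕ) :
    HasSum (fun n : ℤ ↦
        qFactorial q (2 * N) * qFactorialInv q (N - n) * qFactorialInv q (N + n) * f n)
      ((∏ k ∈ Finset.range N, (1 - x * q ^ (k + 1))) *
        ∏ k ∈ Finset.range N, (1 - x⁻¹ * q ^ k)) := by
  induction N with
  | zero =>
    convert hasSum_single (0 : ℤ) ?_ using 1
    · simp [qFactorial, qFactorialInv, hf0]
    · intro n hn
      rcases lt_or_gt_of_ne hn with h | h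
      · simp [qFactorialInv, h.not_ge]
      · simp [qFactorialInv, h.not_ge]
  | succ N ih =>
    set g : ℤ → ℂ := fun n ↦
      qFactorial q (2 * N) * qFactorialInv q (N - n) * qFactorialInv q (N + n) * f n with hg
    -- The new factors multiply out to `1 + q ^ (2 N + 1) - x q ^ (N + 1) - x⁻¹ q ^ N`, and
    -- multiplication by `x` or `x⁻¹` shifts the index.
    have hm := (Equiv.subRight (1 : ℤ)).hasSum_iff.mpr ih
    have hp := (Equiv.addRight (1 : ℤ)).hasSum_iff.mpr ih
    have key := ((ih.mul_left (1 + q ^ (2 * N + 1))).sub (hm.mul_left (x * q ^ (N + 1)))).sub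
      (hp.mul_left (x⁻¹ * q ^ N))
    have hprod : (∏ k ∈ Finset.range (N + 1), (1 - x * q ^ (k + 1))) *
        ∏ k ∈ Finset.range (N + 1), (1 - x⁻¹ * q ^ k) =
        (1 + q ^ (2 * N + 1)) * ((∏ k ∈ Finset.range N, (1 - x * q ^ (k + 1))) *
          ∏ k ∈ Finset.range N, (1 - x⁻¹ * q ^ k)) -
        x * q ^ (N + 1) * ((∏ k ∈ Finset.range N, (1 - x * q ^ (k + 1))) *
          ∏ k ∈ Finset.range N, (1 - x⁻¹ * q ^ k)) -
        x⁻¹ * q ^ N * ((∏ k ∈ Finset.range N, (1 - x * q ^ (k + 1))) *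
          ∏ k ∈ Finset.range N, (1 - x⁻¹ * q ^ k)) := by
      rw [Finset.prod_range_succ, Finset.prod_range_succ]
      field_simp
      ring
    rw [hprod]
    refine key.congr_fun fun n ↦ ?_
    have e1 : qFactorialInv q (N - n) = (1 - q ^ ((N : ℤ) + 1 - n)) *
        qFactorialInv q ((N : ℤ) + 1 - n) := by
      rw [← qFactorialInv_sub_one hq]; congr 1; ring
    have e2 : qFactorialInv q (N - (n + 1)) = (1 - q ^ ((N : ℤ) - n)) *
        qFactorialInv q (N - n) := by
      rw [← qFactorialInv_sub_one hq]; congr 1; ring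
    have e3 : qFactorialInv q (N + n) = (1 - q ^ ((N : ℤ) + 1 + n)) *
        qFactorialInv q ((N : ℤ) + 1 + n) := by
      rw [← qFactorialInv_sub_one hq]; congr 1; ring
    have e4 : qFactorialInv q (N + (n - 1)) = (1 - q ^ ((N : ℤ) + n)) *
        qFactorialInv q (N + n) := by
      rw [← qFactorialInv_sub_one hq]; congr 1; ring
    have e5 : (N : ℤ) - (n - 1) = N + 1 - n := by ring
    have e6 : (N : ℤ) + (n + 1) = N + 1 + n := by ring
    have e7 : qFactorial q (2 * (N + 1)) =
        qFactorial q (2 * N) * (1 - q ^ (2 * N + 1)) * (1 - q ^ (2 * N + 2)) := by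
      rw [show 2 * (N + 1) = 2 * N + 1 + 1 by ring, qFactorial, Finset.prod_range_succ,
        Finset.prod_range_succ, ← qFactorial]
    have e8 : f (n - 1) = -(x * q ^ n)⁻¹ * f n := by
      have := hf (n - 1)
      rw [sub_add_cancel] at this
      rw [this]
      have := zpow_ne_zero n hq0
      field_simp
    simp only [hg, Function.comp_apply, Equiv.subRight_apply, Equiv.coe_addRight]
    push_cast
    rw [e7, e2, e1, e4, e3, e5, e6, e8, hf n]
    have hz := zpow_ne_zero n hq0
    have z1 : q ^ ((N : ℤ) + 1 - n) = q ^ N * q / q ^ n := by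
      rw [zpow_sub₀ hq0, zpow_add_one₀ hq0, zpow_natCast]
    have z2 : q ^ ((N : ℤ) - n) = q ^ N / q ^ n := by
      rw [zpow_sub₀ hq0, zpow_natCast]
    have z3 : q ^ ((N : ℤ) + 1 + n) = q ^ N * q * q ^ n := by
      rw [zpow_add₀ hq0, zpow_add_one₀ hq0, zpow_natCast]
    have z4 : q ^ ((N : ℤ) + n) = q ^ N * q ^ n := by
      rw [zpow_add₀ hq0, zpow_natCast]
    have z5 : q ^ (n + 1) = q ^ n * q := zpow_add_one₀ hq0 n
    have z6 : q ^ (2 * N + 1) = q ^ N * q ^ N * q := by ring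
    have z7 : q ^ (2 * N + 2) = q ^ N * q ^ N * q * q := by ring
    rw [z1, z2, z3, z4, z5, z6, z7, pow_succ]
    generalize q ^ N = Q at *
    generalize q ^ n = y at *
    field_simp
    ring

lemma multipliable_one_sub_mul_pow {q : ℂ} (hq : ‖q‖ < 1) (x : ℂ) :
    Multipliable fun k : ℕ ↦ 1 - x * q ^ k := by
  simp_rw [sub_eq_add_neg]
  refine multipliable_one_add_of_summable ?_
  simpa using (summable_geometric_of_lt_one (norm_nonneg _) hq).mul_left ‖x‖

lemma multipliable_one_sub_mul_pow_succ {q : ℂ} (hq : ‖q‖ < 1) (x : ℂ) :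
    Multipliable fun k : ℕ ↦ 1 - x * q ^ (k + 1) := by
  simpa [pow_succ', mul_assoc] using multipliable_one_sub_mul_pow hq (x * q)

/-- The Jacobi triple product. The theta series `∑ (-1) ^ n q ^ (n (n + 1) / 2) x ^ n` is presented
by its recurrence, which spares the half-integral exponents. -/
theorem tsum_eq_tripleProduct {q x : ℂ} (hq : ‖q‖ < 1) (hq0 : q ≠ 0) (hx : x ≠ 0)
    {f : ℤ → ℂ} (hf0 : f 0 = 1) (hf : ∀ n, f (n + 1) = -(x * q ^ (n + 1)) * f n)
    (hs : Summable fun n ↦ ‖f n‖) :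
    ∑' n, f n = eulerProduct q * (∏' k : ℕ, (1 - x * q ^ (k + 1))) *
      ∏' k : ℕ, (1 - x⁻¹ * q ^ k) := by
  obtain ⟨A, hA⟩ := exists_norm_qFactorial_le hq
  obtain ⟨B, hB0, hB⟩ := exists_norm_qFactorialInv_le hq
  have hE := eulerProduct_ne_zero hq
  have hlim : Tendsto (fun N : ℕ ↦ ∑' n : ℤ,
      qFactorial q (2 * N) * qFactorialInv q (N - n) * qFactorialInv q (N + n) * f n) atTop
      (𝓝 (∑' n, eulerProduct q * (eulerProduct q)⁻¹ * (eulerProduct q)⁻¹ * f n)) := by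
    refine tendsto_tsum_of_dominated_convergence (hs.mul_left (A * B * B)) (fun n ↦ ?_)
      (.of_forall fun N n ↦ ?_)
    · refine (((Tendsto.mul ?_ ?_).mul ?_).mul_const _)
      · exact (tendsto_qFactorial hq).comp (tendsto_id.const_mul_atTop' two_pos)
      · exact tendsto_qFactorialInv hq
          (tendsto_atTop_add_const_right _ (-n) tendsto_natCast_atTop_atTop)
      · exact tendsto_qFactorialInv hq
          (tendsto_atTop_add_const_right _ n tendsto_natCast_atTop_atTop)
    · rw [norm_mul, norm_mul, norm_mul]
      have hA0 : 0 ≤ A := (norm_nonneg _).trans (hA 0)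
      gcongr
      exacts [hA _, hB _, hB _]
  simp_rw [fun N ↦ (hasSum_finite_tripleProduct hq hq0 hx hf0 hf N).tsum_eq] at hlim
  have h2 := tendsto_nhds_unique hlim
    ((multipliable_one_sub_mul_pow_succ hq x).tendsto_prod_tprod_nat.mul
      (multipliable_one_sub_mul_pow hq x⁻¹).tendsto_prod_tprod_nat)
  rw [tsum_mul_left, mul_inv_cancel₀ hE, one_mul] at h2
  rw [mul_assoc, ← h2, mul_inv_cancel_left₀ hE]

/-! ### The odd theta function and its derivatives -/

open Complex in
/-- The `n`-th term of `θ[1; 1](ζ, τ)`. -/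
noncomputable def thetaTerm (n : ℤ) (ζ τ : ℂ) : ℂ :=
  exp (2 * Real.pi * I * (1 / 2 * ((n : ℂ) + 1 / 2) ^ 2 * τ + ((n : ℂ) + 1 / 2) * (ζ + 1 / 2)))

/-- The factor `2πi (n + 1/2)` by which `∂/∂ζ` multiplies the `n`-th term of `θ[1; 1]`. -/
noncomputable def thetaFreq (n : ℤ) : ℂ := 2 * Real.pi * Complex.I * ((n : ℂ) + 1 / 2)

/-- The `k`-th derivative in `ζ` of the odd theta function `θ[1; 1](ζ, τ)`, as the series of the
termwise derivatives; `k = 0` is the function itself. -/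
noncomputable def thetaDeriv (k : ℕ) (ζ τ : ℂ) : ℂ := ∑' n : ℤ, thetaFreq n ^ k * thetaTerm n ζ τ

/-- A characteristic `ε'` amounts to a translation of the argument. -/
lemma theta_one_zero (ε' : ℝ) (τ : ℂ) :
    theta 1 ε' 0 τ = thetaDeriv 0 (((ε' : ℂ) - 1) / 2) τ := by
  simp only [theta, thetaDeriv, thetaTerm, pow_zero, one_mul, Complex.ofReal_one]
  congr! 5
  ring

lemma thetaTerm_add_one (n : ℤ) (ζ τ : ℂ) : thetaTerm n (ζ + 1) τ = -thetaTerm n ζ τ := by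
  rw [thetaTerm, thetaTerm, ← neg_one_mul, ← Complex.exp_pi_mul_I, ← Complex.exp_add,
    Complex.exp_eq_exp_iff_exists_int]
  exact ⟨n, by ring⟩

lemma thetaTerm_neg (n : ℤ) (ζ τ : ℂ) : thetaTerm n (-ζ) τ = -thetaTerm (-1 - n) ζ τ := by
  rw [thetaTerm, thetaTerm, ← neg_one_mul (Complex.exp _), ← Complex.exp_pi_mul_I, ← Complex.exp_add,
    Complex.exp_eq_exp_iff_exists_int]
  exact ⟨n, by push_cast; ring⟩

lemma thetaTerm_succ (n : ℤ) (ζ τ : ℂ) :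
    thetaTerm (n + 1) ζ τ =
      -(Complex.exp (2 * Real.pi * Complex.I * ζ) * nome τ ^ (n + 1)) * thetaTerm n ζ τ := by
  rw [thetaTerm, thetaTerm, nome, ← Complex.exp_int_mul, ← neg_one_mul, ← Complex.exp_pi_mul_I,
    ← Complex.exp_add, ← Complex.exp_add, ← Complex.exp_add]
  congr 1
  push_cast
  ring

lemma thetaDeriv_add_one (k : ℕ) (ζ τ : ℂ) : thetaDeriv k (ζ + 1) τ = -thetaDeriv k ζ τ := by
  simp_rw [thetaDeriv, thetaTerm_add_one, mul_neg, tsum_neg]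

lemma thetaDeriv_neg (k : ℕ) (ζ τ : ℂ) :
    thetaDeriv k (-ζ) τ = (-1) ^ (k + 1) * thetaDeriv k ζ τ := by
  rw [thetaDeriv, thetaDeriv, ← tsum_mul_left, ← (Equiv.subLeft (-1 : ℤ)).tsum_eq]
  refine tsum_congr fun n ↦ ?_
  have h : thetaFreq (-1 - n) = -1 * thetaFreq n := by
    simp only [thetaFreq]; push_cast; ring
  rw [Equiv.subLeft_apply, thetaTerm_neg, h, mul_pow, sub_sub_cancel]
  ring

/-- A bound for the terms that is uniform for `|Im ζ| ≤ S`, `T ≤ Im τ`. -/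
noncomputable def thetaBound (S T : ℝ) (n : ℤ) : ℝ :=
  Real.exp (Real.pi * S) *
    Real.exp (-Real.pi * (T * n ^ 2 - 2 * (S + T / 2) * |n|))

lemma norm_thetaTerm_le {S T : ℝ} (hT : 0 < T) {ζ τ : ℂ} (hζ : |ζ.im| ≤ S) (hτ : T ≤ τ.im)
    (n : ℤ) : ‖thetaTerm n ζ τ‖ ≤ thetaBound S T n := by
  have e : (2 * Real.pi * Complex.I * (1 / 2 * ((n : ℂ) + 1 / 2) ^ 2 * τ +
      ((n : ℂ) + 1 / 2) * (ζ + 1 / 2))) =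
      (((Real.pi * ((n : ℝ) + 1 / 2) ^ 2 : ℝ) : ℂ) * τ +
        ((2 * Real.pi * ((n : ℝ) + 1 / 2) : ℝ) : ℂ) * (ζ + (1 / 2 : ℝ))) * Complex.I := by
    push_cast; ring
  rw [thetaTerm, Complex.norm_exp, e, thetaBound, ← Real.exp_add, Real.exp_le_exp,
    Complex.mul_I_re, Complex.add_im, Complex.im_ofReal_mul, Complex.im_ofReal_mul, Complex.add_im,
    Complex.ofReal_im, add_zero]
  have h1 : ((n : ℝ) + 1 / 2) ^ 2 * τ.im ≥ T * n ^ 2 - T * |(n : ℝ)| := by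
    have : ((n : ℝ) + 1 / 2) ^ 2 ≥ (n : ℝ) ^ 2 - |(n : ℝ)| := by
      nlinarith [neg_abs_le (n : ℝ)]
    nlinarith [sq_nonneg ((n : ℝ) + 1 / 2)]
  have h2 : -(2 * ((n : ℝ) + 1 / 2) * ζ.im) ≤ 2 * S * |(n : ℝ)| + S := by
    have a1 : |(n : ℝ) + 1 / 2| ≤ |(n : ℝ)| + 1 / 2 :=
      (abs_add_le _ _).trans (by norm_num [abs_of_pos])
    have a2 : -(((n : ℝ) + 1 / 2) * ζ.im) ≤ |(n : ℝ) + 1 / 2| * |ζ.im| := by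
      rw [← abs_mul]; exact neg_le_abs _
    have a3 : |(n : ℝ) + 1 / 2| * |ζ.im| ≤ (|(n : ℝ)| + 1 / 2) * S := by gcongr
    linarith
  have h3 := mul_le_mul_of_nonneg_left (by linarith : -(((n : ℝ) + 1 / 2) ^ 2 * τ.im) +
    -(2 * ((n : ℝ) + 1 / 2) * ζ.im) ≤ S - (T * n ^ 2 - T * |(n : ℝ)|) + 2 * S * |(n : ℝ)|)
    Real.pi_pos.le
  push_cast
  linarith

lemma norm_thetaFreq_le (n : ℤ) : ‖thetaFreq n‖ ≤ 2 * Real.pi * (|(n : ℝ)| + 1) := by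
  rw [thetaFreq, norm_mul, norm_mul, norm_mul, Complex.norm_I, Complex.norm_ofNat,
    Complex.norm_of_nonneg Real.pi_pos.le, mul_one]
  gcongr
  refine (norm_add_le _ _).trans ?_
  rw [Complex.norm_intCast]
  norm_num

lemma summable_pow_mul_thetaBound (k : ℕ) (S : ℝ) {T : ℝ} (hT : 0 < T) :
    Summable fun n : ℤ ↦ (2 * Real.pi * (|(n : ℝ)| + 1)) ^ k * thetaBound S T n := by
  have h (k : ℕ) := (summable_pow_mul_jacobiTheta₂_term_bound (S + T / 2) hT k).mul_left
    (Real.exp (Real.pi * S))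
  refine (((h 0).add ((h k).mul_left (2 ^ k))).mul_left ((2 * Real.pi) ^ k)).of_nonneg_of_le
    (fun n ↦ by unfold thetaBound; positivity) fun n ↦ ?_
  have h1 : (|(n : ℝ)| + 1) ^ k ≤ 1 + 2 ^ k * |(n : ℝ)| ^ k := by
    rcases eq_or_ne n 0 with rfl | hn
    · simp only [Int.cast_zero, abs_zero, zero_add, one_pow, le_add_iff_nonneg_right]
      positivity
    · have : (1 : ℝ) ≤ |(n : ℝ)| := by exact_mod_cast Int.one_le_abs hn
      calc (|(n : ℝ)| + 1) ^ k ≤ (2 * |(n : ℝ)|) ^ k := by gcongr; linarith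
        _ ≤ _ := by rw [mul_pow]; linarith
  rw [mul_pow, mul_assoc, thetaBound]
  refine mul_le_mul_of_nonneg_left ?_ (by positivity)
  refine (mul_le_mul_of_nonneg_right h1 (by positivity)).trans (le_of_eq ?_)
  push_cast
  ring

lemma norm_thetaFreq_pow_mul_thetaTerm_le (k : ℕ) {S T : ℝ} (hT : 0 < T) {ζ τ : ℂ}
    (hζ : |ζ.im| ≤ S) (hτ : T ≤ τ.im) (n : ℤ) :
    ‖thetaFreq n ^ k * thetaTerm n ζ τ‖ ≤
      (2 * Real.pi * (|(n : ℝ)| + 1)) ^ k * thetaBound S T n := by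
  rw [norm_mul, norm_pow]
  gcongr
  exacts [norm_thetaFreq_le n, norm_thetaTerm_le hT hζ hτ n]

lemma summable_norm_thetaTerm (ζ : ℂ) {τ : ℂ} (hτ : 0 < τ.im) :
    Summable fun n ↦ ‖thetaTerm n ζ τ‖ := by
  refine (summable_pow_mul_thetaBound 0 |ζ.im| hτ).of_nonneg_of_le (fun _ ↦ norm_nonneg _)
    fun n ↦ ?_
  simpa using norm_thetaFreq_pow_mul_thetaTerm_le 0 hτ le_rfl le_rfl n

lemma hasDerivAt_thetaTerm (n : ℤ) (ζ τ : ℂ) :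
    HasDerivAt (thetaTerm n · τ) (thetaFreq n * thetaTerm n ζ τ) ζ := by
  have h := ((((hasDerivAt_id ζ).add_const (1 / 2 : ℂ)).const_mul ((n : ℂ) + 1 / 2)).const_add
    (1 / 2 * ((n : ℂ) + 1 / 2) ^ 2 * τ)).const_mul (2 * Real.pi * Complex.I) |>.cexp
  refine h.congr_deriv ?_
  simp only [thetaTerm, thetaFreq, id_eq]
  ring

lemma hasDerivAt_thetaTerm_right (n : ℤ) (ζ τ : ℂ) :
    HasDerivAt (thetaTerm n ζ ·)
      (1 / (4 * Real.pi * Complex.I) * (thetaFreq n ^ 2 * thetaTerm n ζ τ)) τ := by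
  have h := (((hasDerivAt_id τ).const_mul (1 / 2 * ((n : ℂ) + 1 / 2) ^ 2)).add_const
    (((n : ℂ) + 1 / 2) * (ζ + 1 / 2))).const_mul (2 * Real.pi * Complex.I) |>.cexp
  refine h.congr_deriv ?_
  have : (Real.pi : ℂ) ≠ 0 := mod_cast Real.pi_ne_zero
  simp only [thetaTerm, thetaFreq, id_eq]
  field_simp [Complex.I_ne_zero]
  ring

lemma hasDerivAt_thetaDeriv (k : ℕ) (ζ : ℂ) {τ : ℂ} (hτ : 0 < τ.im) :
    HasDerivAt (thetaDeriv k · τ) (thetaDeriv (k + 1) ζ τ) ζ := by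
  have hU : IsOpen {z : ℂ | |z.im| < |ζ.im| + 1} :=
    isOpen_lt (by fun_prop) continuous_const
  have hmem : ζ ∈ {z : ℂ | |z.im| < |ζ.im| + 1} := by simp
  have hd (n : ℤ) (z : ℂ) := (hasDerivAt_thetaTerm n z τ).const_mul (thetaFreq n ^ k)
  have hdiff (n : ℤ) : DifferentiableOn ℂ (fun z ↦ thetaFreq n ^ k * thetaTerm n z τ)
      {z : ℂ | |z.im| < |ζ.im| + 1} := fun z _ ↦ (hd n z).differentiableAt.differentiableWithinAt
  have hb (n : ℤ) (z : ℂ) (hz : z ∈ {z : ℂ | |z.im| < |ζ.im| + 1}) :=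
    norm_thetaFreq_pow_mul_thetaTerm_le k hτ (le_of_lt hz) le_rfl n
  have hsum := summable_pow_mul_thetaBound k (|ζ.im| + 1) hτ
  have h1 := (Complex.differentiableOn_tsum_of_summable_norm hsum hdiff hU hb).differentiableAt
    (hU.mem_nhds hmem)
  have h2 := Complex.hasSum_deriv_of_summable_norm hsum hdiff hU hb hmem
  have h3 := h1.hasDerivAt
  rw [← h2.tsum_eq] at h3
  refine h3.congr_deriv (tsum_congr fun n ↦ ?_)
  rw [(hd n ζ).deriv]
  ring

/-- The heat equation `4πi ∂θ/∂τ = ∂²θ/∂ζ²`. -/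
lemma hasDerivAt_thetaDeriv_right (k : ℕ) (ζ : ℂ) {τ : ℂ} (hτ : 0 < τ.im) :
    HasDerivAt (thetaDeriv k ζ ·)
      (1 / (4 * Real.pi * Complex.I) * thetaDeriv (k + 2) ζ τ) τ := by
  have hU : IsOpen {t : ℂ | τ.im / 2 < t.im} := isOpen_lt continuous_const (by fun_prop)
  have hmem : τ ∈ {t : ℂ | τ.im / 2 < t.im} := half_lt_self hτ
  have hd (n : ℤ) (t : ℂ) := (hasDerivAt_thetaTerm_right n ζ t).const_mul (thetaFreq n ^ k)
  have hdiff (n : ℤ) : DifferentiableOn ℂ (fun t ↦ thetaFreq n ^ k * thetaTerm n ζ t)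
      {t : ℂ | τ.im / 2 < t.im} := fun t _ ↦ (hd n t).differentiableAt.differentiableWithinAt
  have hb (n : ℤ) (t : ℂ) (ht : t ∈ {t : ℂ | τ.im / 2 < t.im}) :=
    norm_thetaFreq_pow_mul_thetaTerm_le k (half_pos hτ) (le_refl |ζ.im|) (le_of_lt ht) n
  have hsum := summable_pow_mul_thetaBound k |ζ.im| (half_pos hτ)
  have h1 := (Complex.differentiableOn_tsum_of_summable_norm hsum hdiff hU hb).differentiableAt
    (hU.mem_nhds hmem)
  have h2 := Complex.hasSum_deriv_of_summable_norm hsum hdiff hU hb hmem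
  have h3 := h1.hasDerivAt
  rw [← h2.tsum_eq] at h3
  refine h3.congr_deriv ?_
  rw [thetaDeriv, ← tsum_mul_left]
  refine tsum_congr fun n ↦ ?_
  rw [(hd n τ).deriv]
  ring

/-! ### Addition formulas -/

/-- The terms of the theta series into which the product `θ(x + y) θ(x - y)` separates. -/
noncomputable def squareTerm (a : ℤ) (x τ : ℂ) : ℂ :=
  Complex.exp (Real.pi * Complex.I * ((a : ℂ) ^ 2 * τ / 2 + 2 * a * x))

lemma summable_norm_squareTerm (x : ℂ) {τ : ℂ} (hτ : 0 < τ.im) :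
    Summable fun a ↦ ‖squareTerm a x τ‖ := by
  have h : 0 < (τ / 2).im := by simpa using hτ
  refine ((summable_jacobiTheta₂_term_iff x (τ / 2)).mpr h).norm.congr fun a ↦ ?_
  rw [jacobiTheta₂_term, squareTerm]
  congr 2
  ring

/-- The lattice `ℤ × ℤ`, split according to the parity of `m + n`: the sum and difference of the
shifted indices `m + 1/2`, `n + 1/2` are integers of opposite parity, namely
`(2 * j + 1, 2 * k)` or `(2 * j, 2 * k + 1)`. -/
def parityEquiv : (ℤ × ℤ) ⊕ (ℤ × ℤ) ≃ ℤ × ℤ where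
  toFun := Sum.elim (fun p ↦ (p.1 + p.2, p.1 - p.2)) fun p ↦ (p.1 + p.2, p.1 - p.2 - 1)
  invFun p := if (p.1 + p.2) % 2 = 0 then .inl ((p.1 + p.2) / 2, (p.1 - p.2) / 2)
    else .inr ((p.1 + p.2 + 1) / 2, (p.1 - p.2) / 2)
  left_inv := by
    rintro (⟨j, k⟩ | ⟨j, k⟩)
    · have h : (j + k + (j - k)) % 2 = 0 := by omega
      simp only [Sum.elim_inl, h, if_true, Sum.inl.injEq, Prod.mk.injEq]
      omega
    · have h : ¬ (j + k + (j - k - 1)) % 2 = 0 := by omega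
      simp only [Sum.elim_inr, h, if_false, Sum.inr.injEq, Prod.mk.injEq]
      omega
  right_inv := by
    rintro ⟨m, n⟩
    by_cases h : (m + n) % 2 = 0
    · simp only [h, if_true, Sum.elim_inl, Prod.mk.injEq]
      omega
    · simp only [h, if_false, Sum.elim_inr, Prod.mk.injEq]
      omega

lemma thetaTerm_mul_thetaTerm_inl (j k : ℤ) (x y τ : ℂ) :
    thetaTerm (j + k) (x + y) τ * thetaTerm (j - k) (x - y) τ =
      -(squareTerm (2 * j + 1) x τ * squareTerm (2 * k) y τ) := by
  rw [thetaTerm, thetaTerm, squareTerm, squareTerm, ← neg_one_mul (Complex.exp _ * _),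
    ← Complex.exp_pi_mul_I, ← Complex.exp_add, ← Complex.exp_add, ← Complex.exp_add,
    Complex.exp_eq_exp_iff_exists_int]
  exact ⟨j, by push_cast; ring⟩

lemma thetaTerm_mul_thetaTerm_inr (j k : ℤ) (x y τ : ℂ) :
    thetaTerm (j + k) (x + y) τ * thetaTerm (j - k - 1) (x - y) τ =
      squareTerm (2 * j) x τ * squareTerm (2 * k + 1) y τ := by
  rw [thetaTerm, thetaTerm, squareTerm, squareTerm, ← Complex.exp_add, ← Complex.exp_add,
    Complex.exp_eq_exp_iff_exists_int]
  exact ⟨j, by push_cast; ring⟩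

/-- The product `θ(x + y) θ(x - y)` is a `2 × 2` determinant. -/
lemma theta_add_mul_theta_sub (x y : ℂ) {τ : ℂ} (hτ : 0 < τ.im) :
    thetaDeriv 0 (x + y) τ * thetaDeriv 0 (x - y) τ =
      (∑' j : ℤ, squareTerm (2 * j) x τ) * (∑' k : ℤ, squareTerm (2 * k + 1) y τ) -
      (∑' j : ℤ, squareTerm (2 * j + 1) x τ) * (∑' k : ℤ, squareTerm (2 * k) y τ) := by
  have he (z : ℂ) : Summable fun j : ℤ ↦ ‖squareTerm (2 * j) z τ‖ :=
    (summable_norm_squareTerm z hτ).comp_injective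
      (i := fun j : ℤ ↦ 2 * j) fun a b h ↦ by simpa using h
  have ho (z : ℂ) : Summable fun j : ℤ ↦ ‖squareTerm (2 * j + 1) z τ‖ :=
    (summable_norm_squareTerm z hτ).comp_injective
      (i := fun j : ℤ ↦ 2 * j + 1) fun a b h ↦ by simpa using h
  simp only [thetaDeriv, pow_zero, one_mul]
  rw [tsum_mul_tsum_of_summable_norm (summable_norm_thetaTerm _ hτ) (summable_norm_thetaTerm _ hτ),
    tsum_mul_tsum_of_summable_norm (he x) (ho y), tsum_mul_tsum_of_summable_norm (ho x) (he y),
    ← parityEquiv.tsum_eq, Summable.tsum_sum]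
  · simp only [parityEquiv, Equiv.coe_fn_mk, Sum.elim_inl, Sum.elim_inr,
      thetaTerm_mul_thetaTerm_inl, thetaTerm_mul_thetaTerm_inr, tsum_neg]
    ring
  · refine (summable_mul_of_summable_norm (ho x) (he y)).neg.congr fun p ↦ ?_
    exact (thetaTerm_mul_thetaTerm_inl p.1 p.2 x y τ).symm
  · refine (summable_mul_of_summable_norm (he x) (ho y)).congr fun p ↦ ?_
    exact (thetaTerm_mul_thetaTerm_inr p.1 p.2 x y τ).symm

/-- Weierstrass's three-term identity, the Plücker relation for the determinants of
`theta_add_mul_theta_sub`. -/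
theorem theta_three_term (x y z w : ℂ) {τ : ℂ} (hτ : 0 < τ.im) :
    thetaDeriv 0 (x + y) τ * thetaDeriv 0 (x - y) τ *
        (thetaDeriv 0 (z + w) τ * thetaDeriv 0 (z - w) τ) +
      thetaDeriv 0 (y + z) τ * thetaDeriv 0 (y - z) τ *
        (thetaDeriv 0 (x + w) τ * thetaDeriv 0 (x - w) τ) +
      thetaDeriv 0 (z + x) τ * thetaDeriv 0 (z - x) τ *
        (thetaDeriv 0 (y + w) τ * thetaDeriv 0 (y - w) τ) = 0 := by
  simp only [theta_add_mul_theta_sub _ _ hτ]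
  ring

lemma thetaDeriv_zero_zero (τ : ℂ) : thetaDeriv 0 0 τ = 0 := by
  have h := thetaDeriv_neg 0 0 τ
  rw [neg_zero] at h
  linear_combination h / 2

lemma hasDerivAt_thetaDeriv_const_add (k : ℕ) (y z : ℂ) {τ : ℂ} (hτ : 0 < τ.im) :
    HasDerivAt (fun z ↦ thetaDeriv k (y + z) τ) (thetaDeriv (k + 1) (y + z) τ) z :=
  (hasDerivAt_thetaDeriv k (y + z) hτ).comp_const_add y z

lemma hasDerivAt_thetaDeriv_const_sub (k : ℕ) (y z : ℂ) {τ : ℂ} (hτ : 0 < τ.im) :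
    HasDerivAt (fun z ↦ thetaDeriv k (y - z) τ) (-thetaDeriv (k + 1) (y - z) τ) z :=
  (hasDerivAt_thetaDeriv k (y - z) hτ).comp_const_sub y z

/-- The three-term identity, differentiated in `z` at `z = w`: in logarithmic derivatives
`Z = θ'/θ` it evaluates `Z(y + w) - Z(y - w) - Z(x + w) + Z(x - w)` as a product of thetas. -/
theorem theta_three_term_deriv (x y w : ℂ) {τ : ℂ} (hτ : 0 < τ.im) :
    thetaDeriv 0 (x + y) τ * thetaDeriv 0 (x - y) τ *
        (thetaDeriv 0 (w + w) τ * thetaDeriv 1 0 τ) +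
      (thetaDeriv 1 (y + w) τ * thetaDeriv 0 (y - w) τ -
        thetaDeriv 0 (y + w) τ * thetaDeriv 1 (y - w) τ) *
        (thetaDeriv 0 (x + w) τ * thetaDeriv 0 (x - w) τ) =
      (thetaDeriv 1 (x + w) τ * thetaDeriv 0 (x - w) τ -
        thetaDeriv 0 (x + w) τ * thetaDeriv 1 (x - w) τ) *
        (thetaDeriv 0 (y + w) τ * thetaDeriv 0 (y - w) τ) := by
  have hsub (a z : ℂ) : HasDerivAt (fun z ↦ thetaDeriv 0 (z - a) τ) (thetaDeriv 1 (z - a) τ) z :=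
    (hasDerivAt_thetaDeriv 0 (z - a) hτ).comp_sub_const z a
  have hadd (a z : ℂ) : HasDerivAt (fun z ↦ thetaDeriv 0 (z + a) τ) (thetaDeriv 1 (z + a) τ) z :=
    (hasDerivAt_thetaDeriv 0 (z + a) hτ).comp_add_const z a
  have h := ((((hadd w w).mul (hsub w w)).const_mul
      (thetaDeriv 0 (x + y) τ * thetaDeriv 0 (x - y) τ)).add
    (((hasDerivAt_thetaDeriv_const_add 0 y w hτ).mul
      (hasDerivAt_thetaDeriv_const_sub 0 y w hτ)).mul_const
      (thetaDeriv 0 (x + w) τ * thetaDeriv 0 (x - w) τ))).add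
    (((hadd x w).mul (hsub x w)).mul_const (thetaDeriv 0 (y + w) τ * thetaDeriv 0 (y - w) τ))
  have h0 := h.unique ((hasDerivAt_const w (0 : ℂ)).congr_of_eventuallyEq
    (.of_forall fun z ↦ theta_three_term x y z w hτ))
  have e0 := thetaDeriv_neg 0 (x - w) τ
  have e1 := thetaDeriv_neg 1 (x - w) τ
  rw [neg_sub] at e0 e1
  simp only [zero_add] at h0
  rw [e0, e1, sub_self, thetaDeriv_zero_zero, add_comm w x] at h0
  linear_combination h0

/-- The case `y = 0`, `x = 2 * w`: in logarithmic derivatives,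
`3 Z(w) - Z(3 w) = θ'(0) θ(2 w) ^ 3 / (θ(w) ^ 3 θ(3 w))`. -/
lemma theta_triplication (w : ℂ) {τ : ℂ} (hτ : 0 < τ.im) :
    thetaDeriv 1 0 τ * thetaDeriv 0 (2 * w) τ ^ 3 =
      thetaDeriv 0 w τ ^ 2 * (3 * thetaDeriv 1 w τ * thetaDeriv 0 (3 * w) τ -
        thetaDeriv 0 w τ * thetaDeriv 1 (3 * w) τ) := by
  have h := theta_three_term_deriv (2 * w) 0 w hτ
  rw [add_zero, sub_zero, zero_add, zero_sub, thetaDeriv_neg, thetaDeriv_neg,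
    show w + w = 2 * w by ring, show 2 * w + w = 3 * w by ring,
    show 2 * w - w = w by ring] at h
  linear_combination h

/-- The difference of two values of `Z'`, which is `-℘` up to a constant, is a product of
thetas. -/
lemma theta_logDeriv_deriv_sub (x y : ℂ) {τ : ℂ} (hτ : 0 < τ.im) :
    (thetaDeriv 2 y τ * thetaDeriv 0 y τ - thetaDeriv 1 y τ ^ 2) * thetaDeriv 0 x τ ^ 2 -
      (thetaDeriv 2 x τ * thetaDeriv 0 x τ - thetaDeriv 1 x τ ^ 2) * thetaDeriv 0 y τ ^ 2 =
      -(thetaDeriv 0 (x + y) τ * thetaDeriv 0 (x - y) τ * thetaDeriv 1 0 τ ^ 2) := by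
  -- `theta_three_term_deriv` is odd in `w`; its derivative at `w = 0` carries the information.
  have hd : HasDerivAt (fun w ↦ thetaDeriv 0 (w + w) τ) (thetaDeriv 1 (0 + 0) τ * (1 + 1)) 0 :=
    HasDerivAt.comp (h := fun w ↦ w + w) (h₂ := fun z ↦ thetaDeriv 0 z τ) (0 : ℂ)
      (hasDerivAt_thetaDeriv 0 (0 + 0) hτ) ((hasDerivAt_id' (0 : ℂ)).add (hasDerivAt_id' (0 : ℂ)))
  have hp (k : ℕ) (a : ℂ) := hasDerivAt_thetaDeriv_const_add k a 0 hτ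
  have hm (k : ℕ) (a : ℂ) := hasDerivAt_thetaDeriv_const_sub k a 0 hτ
  have hdiff (a : ℂ) := ((hp 1 a).mul (hm 0 a)).sub ((hp 0 a).mul (hm 1 a))
  have hmul (a : ℂ) := (hp 0 a).mul (hm 0 a)
  have h := (((hd.mul_const (thetaDeriv 1 0 τ)).const_mul
      (thetaDeriv 0 (x + y) τ * thetaDeriv 0 (x - y) τ)).add ((hdiff y).mul (hmul x))).sub
    ((hdiff x).mul (hmul y))
  have h0 := h.unique ((hasDerivAt_const (0 : ℂ) (0 : ℂ)).congr_of_eventuallyEq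
    (.of_forall fun w ↦ sub_eq_zero.mpr (theta_three_term_deriv x y w hτ)))
  simp only [add_zero, sub_zero, Pi.mul_apply, Pi.sub_apply] at h0
  linear_combination h0 / 2

/-! ### The product formula at the five-division points -/

lemma norm_nome_lt_one {τ : ℂ} (hτ : 0 < τ.im) : ‖nome τ‖ < 1 := by
  simpa [nome, Function.Periodic.qParam] using
    Function.Periodic.norm_qParam_lt_one (h := 1) one_pos hτ

lemma nome_ne_zero (τ : ℂ) : nome τ ≠ 0 := Complex.exp_ne_zero _

/-- The infinite product `(x q; q)_∞ = ∏_{k ≥ 1} (1 - x q ^ k)`. -/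
noncomputable def shiftedProduct (q x : ℂ) : ℂ := ∏' k : ℕ, (1 - x * q ^ (k + 1))

lemma shiftedProduct_one (q : ℂ) : shiftedProduct q 1 = eulerProduct q := by
  simp [shiftedProduct, eulerProduct]

lemma shiftedProduct_ne_zero {q x : ℂ} (hq : ‖q‖ < 1) (hx : ‖x‖ = 1) :
    shiftedProduct q x ≠ 0 := by
  have hne (i : ℕ) : 1 + -(x * q ^ (i + 1)) ≠ 0 := by
    intro h
    have h1 : ‖x * q ^ (i + 1)‖ = 1 := by
      rw [← norm_one (α := ℂ)]
      congr 1
      linear_combination -h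
    rw [norm_mul, hx, one_mul, norm_pow] at h1
    exact (pow_lt_one₀ (norm_nonneg _) hq (Nat.succ_ne_zero i)).ne h1
  have h := tprod_one_add_ne_zero_of_summable (f := fun n : ℕ ↦ -(x * q ^ (n + 1))) hne
    (by simpa [hx] using (summable_nat_add_iff 1).mpr
          (summable_geometric_of_lt_one (norm_nonneg _) hq))
  simpa [shiftedProduct, sub_eq_add_neg] using h

lemma continuous_shiftedProduct {q : ℂ} (hq : ‖q‖ < 1) : Continuous (shiftedProduct q) := by
  refine continuous_iff_continuousAt.mpr fun x ↦ ?_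
  have h := tendsto_tprod_one_add_of_dominated_convergence (𝓕 := 𝓝 x)
    (f := fun (y : ℂ) (k : ℕ) ↦ -(y * q ^ (k + 1))) (g := fun k ↦ -(x * q ^ (k + 1)))
    (bound := fun k ↦ (‖x‖ + 1) * ‖q‖ ^ (k + 1))
    (((summable_nat_add_iff 1).mpr (summable_geometric_of_lt_one (norm_nonneg _) hq)).mul_left _)
    (fun k ↦ (tendsto_id.mul_const _).neg) ?_
  · simp only [← sub_eq_add_neg] at h
    exact h
  · filter_upwards [continuous_norm.continuousAt.eventually_lt
      (continuousAt_const (y := ‖x‖ + 1)) (by simp)] with y hy k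
    rw [norm_neg, norm_mul, norm_pow]
    gcongr

/-- The product formula for the odd theta function. -/
theorem thetaDeriv_zero_eq_product (ζ : ℂ) {τ : ℂ} (hτ : 0 < τ.im) :
    thetaDeriv 0 ζ τ = 2 * Complex.I * thetaTerm 0 0 τ * Complex.sin (Real.pi * ζ) *
      (eulerProduct (nome τ) *
        shiftedProduct (nome τ) (Complex.exp (2 * Real.pi * Complex.I * ζ)) *
        shiftedProduct (nome τ) (Complex.exp (2 * Real.pi * Complex.I * ζ))⁻¹) := by
  obtain ⟨x, hx⟩ : ∃ x, x = Complex.exp (2 * Real.pi * Complex.I * ζ) := ⟨_, rfl⟩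
  have hx0 : x ≠ 0 := hx ▸ Complex.exp_ne_zero _
  rw [← hx]
  have hq := norm_nome_lt_one hτ
  have h0 : thetaTerm 0 ζ τ ≠ 0 := Complex.exp_ne_zero _
  have key := tsum_eq_tripleProduct (x := x) hq (nome_ne_zero τ) hx0
    (f := fun n ↦ thetaTerm n ζ τ / thetaTerm 0 ζ τ) (div_self h0)
    (fun n ↦ by rw [thetaTerm_succ, ← hx, mul_div_assoc])
    (by simpa [norm_div] using (summable_norm_thetaTerm ζ hτ).div_const _)
  have hsplit : ∏' k : ℕ, (1 - x⁻¹ * nome τ ^ k) = (1 - x⁻¹) * shiftedProduct (nome τ) x⁻¹ := by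
    rw [tprod_eq_zero_mul' (f := fun k : ℕ ↦ 1 - x⁻¹ * nome τ ^ k)
      (multipliable_one_sub_mul_pow_succ hq x⁻¹), pow_zero, mul_one, shiftedProduct]
  rw [tsum_div_const, hsplit, div_eq_iff h0, ← shiftedProduct] at key
  have hsin : thetaTerm 0 ζ τ * (1 - x⁻¹) =
      2 * Complex.I * thetaTerm 0 0 τ * Complex.sin (Real.pi * ζ) := by
    have e1 : thetaTerm 0 ζ τ = thetaTerm 0 0 τ * Complex.exp (Real.pi * ζ * Complex.I) := by
      rw [thetaTerm, thetaTerm, ← Complex.exp_add]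
      congr 1
      push_cast
      ring
    have e2 : x⁻¹ = Complex.exp (-(Real.pi * ζ) * Complex.I) ^ 2 := by
      rw [hx, ← Complex.exp_neg, ← Complex.exp_nat_mul]
      congr 1
      push_cast
      ring
    have e3 : Complex.exp (Real.pi * ζ * Complex.I) * Complex.exp (-(Real.pi * ζ) * Complex.I)
        = 1 := by
      rw [← Complex.exp_add]; simp
    rw [e1, e2, Complex.sin]
    linear_combination (-(thetaTerm 0 0 τ * Complex.exp (-(Real.pi * ζ) * Complex.I))) * e3
      - thetaTerm 0 0 τ * (Complex.exp (-(Real.pi * ζ) * Complex.I) -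
        Complex.exp (Real.pi * ζ * Complex.I)) * Complex.I_sq
  have h1 : thetaDeriv 0 ζ τ = ∑' n, thetaTerm n ζ τ := by simp [thetaDeriv]
  rw [h1, key, ← hsin]
  ring

/-- Jacobi's formula `θ'(0) = -2π q ^ (1/8) (q; q)_∞ ^ 3`; here `thetaTerm 0 0 τ` is
`i q ^ (1/8)`. -/
lemma thetaDeriv_one_zero {τ : ℂ} (hτ : 0 < τ.im) :
    thetaDeriv 1 0 τ =
      2 * Complex.I * thetaTerm 0 0 τ * Real.pi * eulerProduct (nome τ) ^ 3 := by
  set h : ℂ → ℂ := fun ζ ↦ eulerProduct (nome τ) *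
    shiftedProduct (nome τ) (Complex.exp (2 * Real.pi * Complex.I * ζ)) *
    shiftedProduct (nome τ) (Complex.exp (2 * Real.pi * Complex.I * ζ))⁻¹ with hh
  have hcont : ContinuousAt h 0 := by
    have hc := continuous_shiftedProduct (norm_nome_lt_one hτ)
    have he : Continuous fun ζ : ℂ ↦ Complex.exp (2 * Real.pi * Complex.I * ζ) := by fun_prop
    exact ((continuous_const.mul (hc.comp he)).mul
      (hc.comp (he.inv₀ fun _ ↦ Complex.exp_ne_zero _))).continuousAt
  have hg : HasDerivAt (fun ζ : ℂ ↦ 2 * Complex.I * thetaTerm 0 0 τ * Complex.sin (Real.pi * ζ))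
      (2 * Complex.I * thetaTerm 0 0 τ * Real.pi) 0 := by
    have := (((hasDerivAt_id (0 : ℂ)).const_mul (Real.pi : ℂ)).csin).const_mul
      (2 * Complex.I * thetaTerm 0 0 τ)
    simpa using this
  -- The sine vanishes at `0`, so continuity of the other factor suffices.
  have hd : HasDerivAt (thetaDeriv 0 · τ) (2 * Complex.I * thetaTerm 0 0 τ * Real.pi * h 0) 0 := by
    rw [hasDerivAt_iff_tendsto_slope] at hg ⊢
    refine (hg.mul (hcont.tendsto.mono_left nhdsWithin_le_nhds)).congr fun ζ ↦ ?_
    simp only [slope_def_field, hh]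
    rw [thetaDeriv_zero_eq_product ζ hτ, thetaDeriv_zero_zero, mul_zero, Complex.sin_zero]
    ring
  rw [(hasDerivAt_thetaDeriv 0 0 hτ).unique hd]
  simp only [hh, mul_zero, Complex.exp_zero, inv_one, shiftedProduct_one]
  ring

lemma thetaDeriv_zero_ne_zero {r : ℝ} (hr0 : 0 < r) (hr1 : r < 1) {τ : ℂ} (hτ : 0 < τ.im) :
    thetaDeriv 0 r τ ≠ 0 := by
  have hq := norm_nome_lt_one hτ
  have hx : ‖Complex.exp (2 * Real.pi * Complex.I * r)‖ = 1 := by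
    rw [show 2 * Real.pi * Complex.I * r = ((2 * Real.pi * r : ℝ) : ℂ) * Complex.I by
      push_cast; ring]
    exact Complex.norm_exp_ofReal_mul_I _
  have hsin : Complex.sin (Real.pi * r) ≠ 0 := by
    have : Real.sin (Real.pi * r) ≠ 0 :=
      (Real.sin_pos_of_pos_of_lt_pi (by positivity) (by nlinarith [Real.pi_pos])).ne'
    exact_mod_cast this
  rw [thetaDeriv_zero_eq_product _ hτ]
  exact mul_ne_zero (mul_ne_zero (mul_ne_zero (mul_ne_zero two_ne_zero Complex.I_ne_zero)
    (Complex.exp_ne_zero _)) hsin) (mul_ne_zero (mul_ne_zero (eulerProduct_ne_zero hq)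
    (shiftedProduct_ne_zero hq hx)) (shiftedProduct_ne_zero hq (by rw [norm_inv, hx, inv_one])))

/-- Multiplying `∏ (1 - ζ q ^ k)` over all fifth roots of unity `ζ`. -/
lemma shiftedProduct_prod_fifth_roots {q ω : ℂ} (hq : ‖q‖ < 1) (hω : ω ^ 5 = 1) (hω1 : ω ≠ 1) :
    eulerProduct q * (shiftedProduct q ω * shiftedProduct q ω⁻¹) *
      (shiftedProduct q (ω ^ 2) * shiftedProduct q (ω ^ 2)⁻¹) = eulerProduct (q ^ 5) := by
  have hω0 : ω ≠ 0 := by rintro rfl; simp at hω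
  have hcyc : 1 + ω + ω ^ 2 + ω ^ 3 + ω ^ 4 = 0 := by
    refine (mul_eq_zero.mp ?_).resolve_left (sub_ne_zero.mpr hω1)
    linear_combination hω
  have e1 : ω⁻¹ = ω ^ 4 := by field_simp; exact hω.symm
  have e2 : (ω ^ 2)⁻¹ = ω ^ 3 := by field_simp; exact hω.symm
  have hm (x : ℂ) := multipliable_one_sub_mul_pow_succ hq x
  rw [e1, e2, ← shiftedProduct_one]
  simp only [shiftedProduct, eulerProduct]
  rw [← (hm ω).tprod_mul (hm (ω ^ 4)), ← (hm (ω ^ 2)).tprod_mul (hm (ω ^ 3)),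
    ← (hm 1).tprod_mul ((hm ω).mul (hm (ω ^ 4))),
    ← ((hm 1).mul ((hm ω).mul (hm (ω ^ 4)))).tprod_mul ((hm (ω ^ 2)).mul (hm (ω ^ 3)))]
  refine tprod_congr fun k ↦ ?_
  rw [← pow_mul, mul_comm 5, pow_mul]
  generalize q ^ (k + 1) = y
  -- The sums `ω + ω⁻¹` and `ω ^ 2 + ω⁻²` are the roots of `X ^ 2 + X - 1`.
  have hst : (ω + ω ^ 4) * (ω ^ 2 + ω ^ 3) = -1 := by
    linear_combination (ω + ω ^ 2) * hω + hcyc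
  have ht : ω ^ 2 + ω ^ 3 = -1 - (ω + ω ^ 4) := by linear_combination hcyc
  have f1 : (1 - ω * y) * (1 - ω ^ 4 * y) = 1 - (ω + ω ^ 4) * y + y ^ 2 := by
    linear_combination y ^ 2 * hω
  have f2 : (1 - ω ^ 2 * y) * (1 - ω ^ 3 * y) = 1 - (ω ^ 2 + ω ^ 3) * y + y ^ 2 := by
    linear_combination y ^ 2 * hω
  rw [f1, f2, ht]
  rw [ht] at hst
  linear_combination (1 - y) * y ^ 2 * hst

/-- The product formula at `1/5` and `2/5`, compared with Jacobi's formula for `θ'(0)`. -/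
lemma thetaDeriv_one_zero_sq_mul {τ : ℂ} (hτ : 0 < τ.im) :
    ((Real.sqrt 5 : ℝ) : ℂ) * thetaDeriv 1 0 τ ^ 2 * eulerProduct (nome τ ^ 5) =
      4 * Real.pi ^ 2 * eulerProduct (nome τ) ^ 5 *
        (thetaDeriv 0 (1 / 5) τ * thetaDeriv 0 (2 / 5) τ) := by
  set ω := Complex.exp (2 * Real.pi * Complex.I * (1 / 5)) with hω
  have hω2 : Complex.exp (2 * Real.pi * Complex.I * (2 / 5)) = ω ^ 2 := by
    rw [hω, ← Complex.exp_nat_mul]; congr 1; push_cast; ring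
  have hprim : IsPrimitiveRoot ω 5 := by
    have := Complex.isPrimitiveRoot_exp 5 (by norm_num)
    convert this using 2
    push_cast; ring
  have hroots := shiftedProduct_prod_fifth_roots (norm_nome_lt_one hτ) hprim.pow_eq_one
    (hprim.ne_one (by norm_num))
  have hsin : Complex.sin (Real.pi * (1 / 5)) * Complex.sin (Real.pi * (2 / 5)) =
      ((Real.sqrt 5 : ℝ) : ℂ) / 4 := by
    have h : Real.sin (Real.pi * (1 / 5)) * Real.sin (Real.pi * (2 / 5)) = Real.sqrt 5 / 4 := by
      have e1 : Real.pi * (1 / 5) = Real.pi / 5 := by ring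
      have e2 : Real.pi * (2 / 5) = 2 * (Real.pi / 5) := by ring
      have h5 : Real.sqrt 5 ^ 2 = 5 := Real.sq_sqrt (by norm_num)
      rw [e1, e2, Real.sin_two_mul]
      have hs := Real.sin_sq_add_cos_sq (Real.pi / 5)
      rw [Real.cos_pi_div_five] at hs ⊢
      linear_combination (1 + Real.sqrt 5) / 2 * hs - (3 + Real.sqrt 5) / 32 * h5
    have := congrArg (fun r : ℝ ↦ (r : ℂ)) h
    push_cast at this
    exact this
  rw [thetaDeriv_one_zero hτ, thetaDeriv_zero_eq_product (1 / 5) hτ,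
    thetaDeriv_zero_eq_product (2 / 5) hτ, ← hω, hω2, ← hroots]
  linear_combination (-4) * Real.pi ^ 2 * eulerProduct (nome τ) ^ 7 *
    (2 * Complex.I * thetaTerm 0 0 τ) ^ 2 *
    (shiftedProduct (nome τ) ω * shiftedProduct (nome τ) ω⁻¹) *
      (shiftedProduct (nome τ) (ω ^ 2) * shiftedProduct (nome τ) (ω ^ 2)⁻¹) * hsin

/-! ### The Riccati equation -/

/-- The algebra behind the Riccati equation. In terms of `u = 3 d₁/T₁ + d₂/T₂` and
`v = d₁/T₁ - 3 d₂/T₂`, the hypotheses say `u = W v`, `u v = s ^ 2 / (T₁ T₂)` and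
`(h₂/T₂ - (d₂/T₂) ^ 2) - (h₁/T₁ - (d₁/T₁) ^ 2) = u v`, and the left-hand side is `W` times a
quadratic form in `u` and `v`. -/
lemma riccati_algebra {T₁ T₂ d₁ d₂ h₁ h₂ s : ℂ} (hT₁ : T₁ ≠ 0) (hT₂ : T₂ ≠ 0)
    (hu : s * T₂ ^ 3 = T₁ ^ 2 * (3 * d₁ * T₂ + T₁ * d₂))
    (hv : s * T₁ ^ 3 = T₂ ^ 2 * (d₁ * T₂ - 3 * d₂ * T₁))
    (hw : (h₂ * T₂ - d₂ ^ 2) * T₁ ^ 2 - (h₁ * T₁ - d₁ ^ 2) * T₂ ^ 2 = T₁ * T₂ * s ^ 2) :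
    5 * (h₁ / T₁ - h₂ / T₂) * (T₂ ^ 5 / T₁ ^ 5) =
      2 / 5 * (s ^ 2 / (T₁ * T₂)) *
        ((T₂ ^ 5 / T₁ ^ 5) ^ 2 - 11 * (T₂ ^ 5 / T₁ ^ 5) - 1) := by
  -- `d₁/T₁ = (3 u + v) / 10` and `d₂/T₂ = (u - 3 v) / 10`.
  have hd₁ : d₁ = T₁ * (3 * (s * T₂ ^ 2 / T₁ ^ 3) + s * T₁ ^ 2 / T₂ ^ 3) / 10 := by
    field_simp
    linear_combination (-3 * T₂ ^ 2) * hu - T₁ ^ 2 * hv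
  have hd₂ : d₂ = T₂ * (s * T₂ ^ 2 / T₁ ^ 3 - 3 * (s * T₁ ^ 2 / T₂ ^ 3)) / 10 := by
    field_simp
    linear_combination (-T₂ ^ 2) * hu + 3 * T₁ ^ 2 * hv
  have hh : h₁ / T₁ - h₂ / T₂ = (d₁ / T₁) ^ 2 - (d₂ / T₂) ^ 2 - s ^ 2 / (T₁ * T₂) := by
    field_simp
    linear_combination -hw
  rw [hh, hd₁, hd₂]
  field_simp
  ring

lemma W_eq (τ : ℂ) : W τ = thetaDeriv 0 (2 / 5) τ ^ 5 / thetaDeriv 0 (1 / 5) τ ^ 5 := by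
  have h1 : (((1 / 5 : ℝ) : ℂ) - 1) / 2 = -(2 / 5) := by push_cast; ring
  have h2 : (((3 / 5 : ℝ) : ℂ) - 1) / 2 = -(1 / 5) := by push_cast; ring
  rw [W, theta_one_zero, theta_one_zero, h1, h2, thetaDeriv_neg, thetaDeriv_neg]
  simp only [zero_add, pow_one, neg_one_mul, Odd.neg_pow (by decide : Odd 5), neg_div_neg_eq]

lemma thetaDeriv_zero_add_one_right (ζ τ : ℂ) :
    thetaDeriv 0 ζ (τ + 1) = Complex.exp (Real.pi * Complex.I / 4) * thetaDeriv 0 ζ τ := by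
  simp only [thetaDeriv, pow_zero, one_mul]
  rw [← tsum_mul_left]
  refine tsum_congr fun n ↦ ?_
  obtain ⟨m, hm⟩ := Int.even_mul_succ_self n
  have hm' : (n : ℂ) * (n + 1) = m + m := by exact_mod_cast hm
  rw [thetaTerm, thetaTerm, ← Complex.exp_add, Complex.exp_eq_exp_iff_exists_int]
  exact ⟨m, by linear_combination Real.pi * Complex.I * hm'⟩

lemma W_periodic : Function.Periodic W ((1 : ℝ) : ℂ) := fun τ ↦ by
  rw [Complex.ofReal_one, W_eq, W_eq, thetaDeriv_zero_add_one_right, thetaDeriv_zero_add_one_right,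
    mul_pow, mul_pow, mul_div_mul_left _ _ (pow_ne_zero _ (Complex.exp_ne_zero _))]

lemma nome_eq_qParam : nome = Function.Periodic.qParam 1 := by
  ext τ
  simp [nome, Function.Periodic.qParam]

lemma thetaDeriv_one_fifth_ne_zero {τ : ℂ} (hτ : 0 < τ.im) : thetaDeriv 0 (1 / 5) τ ≠ 0 := by
  simpa using thetaDeriv_zero_ne_zero (r := 1 / 5) (by norm_num) (by norm_num) hτ

lemma thetaDeriv_two_fifths_ne_zero {τ : ℂ} (hτ : 0 < τ.im) : thetaDeriv 0 (2 / 5) τ ≠ 0 := by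
  simpa using thetaDeriv_zero_ne_zero (r := 2 / 5) (by norm_num) (by norm_num) hτ

/-- The Riccati equation in the variable `τ`. -/
theorem hasDerivAt_W {τ : ℂ} (hτ : 0 < τ.im) :
    HasDerivAt W (2 * Real.pi * Complex.I * (1 / ((Real.sqrt 5 : ℝ) : ℂ) ^ 3 *
      (eulerProduct (nome τ) ^ 5 / eulerProduct (nome τ ^ 5)) *
      (W τ ^ 2 - 11 * W τ - 1))) τ := by
  have hT₁ := thetaDeriv_one_fifth_ne_zero hτ
  have hT₂ := thetaDeriv_two_fifths_ne_zero hτ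
  have hE : eulerProduct (nome τ ^ 5) ≠ 0 := eulerProduct_ne_zero <| by
    rw [norm_pow]
    exact pow_lt_one₀ (norm_nonneg _) (norm_nome_lt_one hτ) (by norm_num)
  have hs5 : ((Real.sqrt 5 : ℝ) : ℂ) ^ 2 = 5 := by
    exact_mod_cast Real.sq_sqrt (by norm_num : (0 : ℝ) ≤ 5)
  have hs0 : ((Real.sqrt 5 : ℝ) : ℂ) ≠ 0 := by
    intro h
    rw [h] at hs5
    norm_num at hs5
  have hπ : (Real.pi : ℂ) ≠ 0 := mod_cast Real.pi_ne_zero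
  -- The values at `3/5`, `4/5` and `6/5` reduce to those at `1/5` and `2/5`.
  have r3 (k : ℕ) : thetaDeriv k (3 / 5) τ = (-1) ^ k * thetaDeriv k (2 / 5) τ := by
    rw [show (3 / 5 : ℂ) = -(2 / 5) + 1 by norm_num, thetaDeriv_add_one, thetaDeriv_neg]
    ring
  have r4 (k : ℕ) : thetaDeriv k (4 / 5) τ = (-1) ^ k * thetaDeriv k (1 / 5) τ := by
    rw [show (4 / 5 : ℂ) = -(1 / 5) + 1 by norm_num, thetaDeriv_add_one, thetaDeriv_neg]
    ring
  have r6 (k : ℕ) : thetaDeriv k (6 / 5) τ = -thetaDeriv k (1 / 5) τ := by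
    rw [show (6 / 5 : ℂ) = 1 / 5 + 1 by norm_num, thetaDeriv_add_one]
  have hu := theta_triplication (1 / 5) hτ
  have hv := theta_triplication (2 / 5) hτ
  have hw := theta_logDeriv_deriv_sub (1 / 5) (2 / 5) hτ
  rw [show (2 * (1 / 5) : ℂ) = 2 / 5 by norm_num, show (3 * (1 / 5) : ℂ) = 3 / 5 by norm_num,
    r3, r3] at hu
  rw [show (2 * (2 / 5) : ℂ) = 4 / 5 by norm_num, show (3 * (2 / 5) : ℂ) = 6 / 5 by norm_num,
    r4, r6, r6] at hv
  rw [show (1 / 5 + 2 / 5 : ℂ) = 3 / 5 by norm_num, show (1 / 5 - 2 / 5 : ℂ) = -(1 / 5) by norm_num,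
    r3, thetaDeriv_neg] at hw
  have key := riccati_algebra (d₁ := thetaDeriv 1 (1 / 5) τ) (d₂ := thetaDeriv 1 (2 / 5) τ)
    (h₁ := thetaDeriv 2 (1 / 5) τ) (h₂ := thetaDeriv 2 (2 / 5) τ) (s := thetaDeriv 1 0 τ) hT₁ hT₂
    (by linear_combination hu) (by linear_combination hv) (by linear_combination hw)
  have hprod : thetaDeriv 1 0 τ ^ 2 / (thetaDeriv 0 (1 / 5) τ * thetaDeriv 0 (2 / 5) τ) =
      4 * Real.pi ^ 2 / ((Real.sqrt 5 : ℝ) : ℂ) *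
        (eulerProduct (nome τ) ^ 5 / eulerProduct (nome τ ^ 5)) := by
    rw [div_mul_div_comm, div_eq_div_iff (mul_ne_zero hT₁ hT₂) (mul_ne_zero hs0 hE)]
    linear_combination thetaDeriv_one_zero_sq_mul hτ
  rw [hprod, ← W_eq] at key
  have hd := ((hasDerivAt_thetaDeriv_right 0 (2 / 5) hτ).pow 5).div
    ((hasDerivAt_thetaDeriv_right 0 (1 / 5) hτ).pow 5) (pow_ne_zero 5 hT₁)
  refine (hd.congr_of_eventuallyEq (.of_forall fun t ↦ W_eq t)).congr_deriv ?_
  have hc : (1 : ℂ) / ((Real.sqrt 5 : ℝ) : ℂ) ^ 3 = 1 / (5 * ((Real.sqrt 5 : ℝ) : ℂ)) := by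
    rw [pow_succ, hs5]
  rw [hc]
  have hI : Complex.I ^ 2 = -1 := Complex.I_sq
  have e : 2 * Real.pi * Complex.I * (1 / (5 * ((Real.sqrt 5 : ℝ) : ℂ)) *
      (eulerProduct (nome τ) ^ 5 / eulerProduct (nome τ ^ 5)) * (W τ ^ 2 - 11 * W τ - 1)) =
      Complex.I / (4 * Real.pi) * (2 / 5 * (4 * Real.pi ^ 2 / ((Real.sqrt 5 : ℝ) : ℂ) *
        (eulerProduct (nome τ) ^ 5 / eulerProduct (nome τ ^ 5))) *
        (W τ ^ 2 - 11 * W τ - 1)) := by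
    field_simp
  have hI' : 1 / (4 * Real.pi * Complex.I) = -(Complex.I / (4 * Real.pi)) := by
    have := Complex.I_ne_zero
    field_simp
    linear_combination hI
  rw [e, ← key, W_eq, hI']
  simp only [zero_add, Pi.pow_apply]
  push_cast
  field_simp
  ring

end LevelFive

/-- The quotient `W` is well defined on the upper half plane, it is a function `F` of
`q = exp (2πiτ)` on the punctured unit disc, and `F` is complex differentiable there and satisfies
`q dF/dq = 5^(-3/2) (q;q)_∞⁵ / (q⁵;q⁵)_∞ (F² - 11 F - 1)`. -/
theorem mainTheorem1 :
    (∀ τ : ℂ, 0 < τ.im → LevelFive.theta 1 (3 / 5) 0 τ ≠ 0) ∧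
    ∃ F : ℂ → ℂ,
      (∀ τ : ℂ, 0 < τ.im → F (LevelFive.nome τ) = LevelFive.W τ) ∧
      ∀ τ : ℂ, 0 < τ.im →
        DifferentiableAt ℂ F (LevelFive.nome τ) ∧
        LevelFive.nome τ * deriv F (LevelFive.nome τ) =
          1 / ((Real.sqrt 5 : ℝ) : ℂ) ^ 3 *
            (LevelFive.eulerProduct (LevelFive.nome τ) ^ 5 /
              LevelFive.eulerProduct (LevelFive.nome τ ^ 5)) *
            (LevelFive.W τ ^ 2 - 11 * LevelFive.W τ - 1) := by
  refine ⟨fun τ hτ ↦ ?_, Function.Periodic.cuspFunction 1 LevelFive.W, fun τ _ ↦ ?_, fun τ hτ ↦ ?_⟩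
  · have h2 : (((3 / 5 : ℝ) : ℂ) - 1) / 2 = -(1 / 5) := by push_cast; ring
    rw [LevelFive.theta_one_zero, h2, LevelFive.thetaDeriv_neg]
    simpa using LevelFive.thetaDeriv_one_fifth_ne_zero hτ
  · rw [LevelFive.nome_eq_qParam]
    exact Function.Periodic.eq_cuspFunction one_ne_zero LevelFive.W_periodic τ
  · have hW := LevelFive.hasDerivAt_W hτ
    have hF : DifferentiableAt ℂ (Function.Periodic.cuspFunction 1 LevelFive.W)
        (LevelFive.nome τ) := by
      rw [LevelFive.nome_eq_qParam]
      exact Function.Periodic.differentiableAt_cuspFunction one_ne_zero LevelFive.W_periodic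
        hW.differentiableAt
    refine ⟨hF, ?_⟩
    have hn : HasDerivAt LevelFive.nome
        (LevelFive.nome τ * (2 * Real.pi * Complex.I)) τ := by
      simpa using! ((hasDerivAt_id τ).const_mul (2 * Real.pi * Complex.I)).cexp
    -- `F ∘ nome = W`, and the chain rule turns `q d/dq` into `(2πi)⁻¹ d/dτ`.
    have hcomp : Function.Periodic.cuspFunction 1 LevelFive.W ∘ LevelFive.nome = LevelFive.W := by
      ext t
      rw [Function.comp_apply, LevelFive.nome_eq_qParam]
      exact Function.Periodic.eq_cuspFunction one_ne_zero LevelFive.W_periodic t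
    have h := hF.hasDerivAt.comp τ hn
    rw [hcomp] at h
    refine mul_left_cancel₀ Complex.two_pi_I_ne_zero ?_
    rw [← h.unique hW]
    ring
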